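/- Let $d>0$ be fixed. For each $n\ge 1$ let $\boldsymbol A$ be a random $n\times n$ matrix over $\mathbb F_2$ whose entries are independent and each equal to $1$ with probability $\min(d/n,1)$ and to $0$ otherwise. Let $$f(\boldsymbol A)=\frac1n\,\bigl|\{i\in\{1,\dots,n\}:\ x_i=0\text{ for all }x\in\ker\boldsymbol A\}\bigr|$$ be the fraction of frozen coordinates. Given $\boldsymbol A$, let $\boldsymbol x,\boldsymbol x'$ be independent and uniformly distributed on $\ker\boldsymbol A=\{x\in\mathbb F_2^n:\boldsymbol Ax=0\}$, and let $$R(\boldsymbol x,\boldsymbol x')=\frac1n\sum_{i=1}^n \mathbf 1\{\boldsymbol x_i=\boldsymbol x'_i\}$$ be their overlap. Then $$\lim_{n\to\infty}\mathbb E\left|R(\boldsymbol x,\boldsymbol x')-\frac{1+f(\boldsymbol A)}2\right|=0,$$ where the expectation is over $\boldsymbol A$, $\boldsymbol x$ and $\boldsymbol x'$ jointly. -/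

import Mathlib

open scoped BigOperators NNReal ENNReal

noncomputable section

namespace SparseParity

/-- The probability `(d / n) ∧ 1` with which an entry of the random matrix equals one. -/
def entryProb (d : ℝ) (n : ℕ) : ℝ≥0 := min (Real.toNNReal (d / n)) 1

/-- The probability that a single entry takes the value `b` when it equals one with
probability `p`. -/
def entryWeight (p : ℝ≥0) (b : ZMod 2) : ℝ≥0∞ :=
  if b = 1 then (p : ℝ≥0∞) else ((1 - p : ℝ≥0) : ℝ≥0∞)

theorem sum_entryWeight {p : ℝ≥0} (hp : p ≤ 1) : ∑ b : ZMod 2, entryWeight p b = 1 := by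
  have h : (Finset.univ : Finset (ZMod 2)) = {0, 1} := by decide
  rw [h, Finset.sum_pair (by decide)]
  simp only [entryWeight, if_true, if_neg (show ¬ (0 : ZMod 2) = 1 by decide)]
  rw [← ENNReal.coe_add, tsub_add_cancel_of_le hp, ENNReal.coe_one]

theorem sum_prod_entryWeight {p : ℝ≥0} (hp : p ≤ 1) (n : ℕ) :
    ∑ A : Matrix (Fin n) (Fin n) (ZMod 2), ∏ i, ∏ j, entryWeight p (A i j) = 1 := by
  have h1 : ∑ v : Fin n → ZMod 2, ∏ j, entryWeight p (v j) = 1 := by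
    have h := Finset.prod_univ_sum (fun _ : Fin n => (Finset.univ : Finset (ZMod 2)))
      (fun _ b => entryWeight p b)
    rw [Fintype.piFinset_univ] at h
    rw [← h]
    simp [sum_entryWeight hp]
  have h := Finset.prod_univ_sum (fun _ : Fin n => (Finset.univ : Finset (Fin n → ZMod 2)))
    (fun _ v => ∏ j, entryWeight p (v j))
  rw [Fintype.piFinset_univ] at h
  refine Eq.trans h.symm ?_
  simp [h1]

/-- The law of the random `n × n` matrix over `𝔽₂` whose entries are independent and equal one
with probability `(d / n) ∧ 1`. -/
def matrixLaw (d : ℝ) (n : ℕ) : PMF (Matrix (Fin n) (Fin n) (ZMod 2)) :=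
  PMF.ofFintype (fun A => ∏ i, ∏ j, entryWeight (entryProb d n) (A i j))
    (sum_prod_entryWeight (min_le_right _ _) n)

/-- The kernel of `A`, a subspace of `𝔽₂ⁿ`. -/
abbrev kernel {n : ℕ} (A : Matrix (Fin n) (Fin n) (ZMod 2)) :
    Submodule (ZMod 2) (Fin n → ZMod 2) :=
  LinearMap.ker A.mulVecLin

open Classical in
/-- The uniform distribution on the kernel of `A`, as a distribution on `𝔽₂ⁿ`. -/
def uniformKernel {n : ℕ} (A : Matrix (Fin n) (Fin n) (ZMod 2)) : PMF (Fin n → ZMod 2) :=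
  (PMF.uniformOfFintype (kernel A)).map Subtype.val

/-- The joint law of `(A, x, x')`: the matrix `A` has law `matrixLaw d n` and, given `A`, the
vectors `x` and `x'` are independent and uniformly distributed on the kernel of `A`. -/
def jointLaw (d : ℝ) (n : ℕ) :
    PMF (Matrix (Fin n) (Fin n) (ZMod 2) × (Fin n → ZMod 2) × (Fin n → ZMod 2)) :=
  (matrixLaw d n).bind fun A =>
    (uniformKernel A).bind fun x =>
      (uniformKernel A).bind fun x' => PMF.pure (A, x, x')

/-- The expectation of a real random variable on a finite probability space. -/
def expectation {Ω : Type*} [Fintype Ω] (μ : PMF Ω) (X : Ω → ℝ) : ℝ :=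
  ∑ ω, (μ ω).toReal * X ω

/-- The fraction `f(A)` of frozen coordinates, i.e. of those `i` with `x i = 0` for all `x` in
the kernel of `A`. -/
def frozenFraction {n : ℕ} (A : Matrix (Fin n) (Fin n) (ZMod 2)) : ℝ :=
  ({i : Fin n | ∀ x ∈ kernel A, x i = 0}.ncard : ℝ) / n

/-- The overlap `R(x, x')`, the fraction of coordinates in which `x` and `x'` agree. -/
def overlap {n : ℕ} (x x' : Fin n → ZMod 2) : ℝ :=
  (∑ i : Fin n, if x i = x' i then (1 : ℝ) else 0) / n

end SparseParity

end

/-! Given `A`, the overlap counts the zeros of `x - x'`, a uniform element of the kernel. Its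
conditional mean is `(1 + f(A)) / 2`, and orthogonality of characters shows that its conditional
variance is the number of locked pairs over `4 n ^ 2` (`sum_uniformKernel_overlap_sq`). So it
suffices that locked pairs are `o(n ^ 2)` on average.

Replacing a zero row by a unit row at a uniformly random `j` pins coordinate `j`, which raises the
mean frozen fraction by exactly the number of locked pairs over `n ^ 2`
(`sum_card_frozenSet_pinned`). But forcing a random row to be zero, or to be a uniform unit vector,
hardly changes the law of the matrix: the numbers of such rows have means of order `n` and
concentrate (`abs_sum_prod_sub_average_le`). Hence the mean frozen fraction barely moves, and the
locked pairs are negligible (`sum_lockedPairs_le`). -/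

namespace SparseParity

/-! ### Product measures: conditioning a random coordinate -/

section Resampling

variable {ι α : Type*} [Fintype ι] [DecidableEq ι] [Fintype α]

/-- Resampling one coordinate of a product measure leaves the measure unchanged. -/
theorem sum_prod_resample (ρ : α → ℝ) (hρ : ∑ v, ρ v = 1) (r : ι) (G : (ι → α) → ℝ) :
    ∑ A : ι → α, ∑ v, (∏ i, ρ (A i)) * ρ v * G (Function.update A r v) =
      ∑ A : ι → α, (∏ i, ρ (A i)) * G A := by
  have hR : ∑ A : ι → α, (∏ i, ρ (A i)) * G A =
      ∑ A : ι → α, ∑ v, (∏ i, ρ (A i)) * ρ v * G A := by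
    refine Finset.sum_congr rfl fun A _ => ?_
    rw [← Finset.sum_mul, ← Finset.mul_sum, hρ, mul_one]
  rw [hR, ← Fintype.sum_prod_type', ← Fintype.sum_prod_type']
  -- The involution exchanging the fresh value with the old entry at `r` preserves the total weight.
  let e : (ι → α) × α ≃ (ι → α) × α :=
    { toFun := fun z => (Function.update z.1 r z.2, z.1 r)
      invFun := fun z => (Function.update z.1 r z.2, z.1 r)
      left_inv := fun z => by simp
      right_inv := fun z => by simp }
  refine Fintype.sum_equiv e _ _ fun z => ?_
  obtain ⟨A, v⟩ := z
  change _ = (∏ i, ρ (Function.update A r v i)) * ρ (A r) * G (Function.update A r v)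
  congr 1
  have h : ∏ i ∈ {r}ᶜ, ρ (Function.update A r v i) = ∏ i ∈ {r}ᶜ, ρ (A i) := by
    refine Finset.prod_congr rfl fun i hi => ?_
    rw [Function.update_of_ne (by simpa using hi)]
  rw [Fintype.prod_eq_mul_prod_compl r, Fintype.prod_eq_mul_prod_compl r, h,
    Function.update_self]
  ring

theorem sum_prod_eq_one (ρ : α → ℝ) (hρ : ∑ v, ρ v = 1) :
    ∑ A : ι → α, ∏ i, ρ (A i) = 1 := by
  have h := Finset.prod_univ_sum (fun _ : ι => (Finset.univ : Finset α)) (fun _ v => ρ v)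
  rw [Fintype.piFinset_univ] at h
  rw [← h]
  simp [hρ]

variable [DecidableEq α]

/-- After resampling coordinate `r`, the indicator constrains only the fresh value. -/
theorem sum_prod_mul_indicator (ρ : α → ℝ) (hρ : ∑ v, ρ v = 1) (S : Finset α) (r : ι)
    (G : (ι → α) → ℝ) :
    ∑ A : ι → α, (∏ i, ρ (A i)) * ((if A r ∈ S then 1 else 0) * G A) =
      ∑ A : ι → α, (∏ i, ρ (A i)) * ∑ v ∈ S, ρ v * G (Function.update A r v) := by
  rw [← sum_prod_resample ρ hρ r]
  refine Finset.sum_congr rfl fun A _ => ?_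
  rw [Finset.mul_sum, ← Finset.sum_subset (Finset.subset_univ S)]
  · refine Finset.sum_congr rfl fun v hv => ?_
    rw [Function.update_self, if_pos hv]
    ring
  · intro v _ hv
    rw [Function.update_self, if_neg hv]
    ring

theorem sum_prod_indicator (ρ : α → ℝ) (hρ : ∑ v, ρ v = 1) (S : Finset α) (r : ι) :
    ∑ A : ι → α, (∏ i, ρ (A i)) * (if A r ∈ S then 1 else 0) = ∑ v ∈ S, ρ v := by
  have h := sum_prod_mul_indicator ρ hρ S r (fun _ => 1)
  simp only [mul_one] at h
  rw [h, ← Finset.sum_mul, sum_prod_eq_one ρ hρ, one_mul]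

theorem sum_prod_indicator_mul_indicator (ρ : α → ℝ) (hρ : ∑ v, ρ v = 1) (S : Finset α)
    {r s : ι} (hrs : r ≠ s) :
    ∑ A : ι → α, (∏ i, ρ (A i)) *
      ((if A r ∈ S then 1 else 0) * (if A s ∈ S then 1 else 0)) = (∑ v ∈ S, ρ v) ^ 2 := by
  rw [sum_prod_mul_indicator ρ hρ S r (fun A => if A s ∈ S then 1 else 0)]
  simp only [Function.update_of_ne hrs.symm, ← Finset.sum_mul]
  calc _ = (∑ v ∈ S, ρ v) * ∑ A : ι → α, (∏ i, ρ (A i)) * (if A s ∈ S then 1 else 0) := by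
        rw [Finset.mul_sum]
        exact Finset.sum_congr rfl fun A _ => by ring
    _ = _ := by rw [sum_prod_indicator ρ hρ, sq]

/-- The variance of the number of coordinates that lie in `S`. -/
theorem sum_prod_count_sub_sq_le (ρ : α → ℝ) (hρ : ∑ v, ρ v = 1) (S : Finset α) :
    ∑ A : ι → α, (∏ i, ρ (A i)) *
      ((∑ r, if A r ∈ S then (1 : ℝ) else 0) - Fintype.card ι * ∑ v ∈ S, ρ v) ^ 2 ≤
      Fintype.card ι * ∑ v ∈ S, ρ v := by
  set σ := ∑ v ∈ S, ρ v with hσ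
  set c : (ι → α) → ι → ℝ := fun A r => if A r ∈ S then (1 : ℝ) else 0 with hc
  have hpair : ∀ r s, ∑ A : ι → α, (∏ i, ρ (A i)) * ((c A r - σ) * (c A s - σ)) =
      if r = s then σ - σ ^ 2 else 0 := by
    intro r s
    have hex : ∑ A : ι → α, (∏ i, ρ (A i)) * ((c A r - σ) * (c A s - σ)) =
        ∑ A : ι → α, (∏ i, ρ (A i)) * (c A r * c A s)
        - σ * ∑ A : ι → α, (∏ i, ρ (A i)) * c A r
        - σ * ∑ A : ι → α, (∏ i, ρ (A i)) * c A s
        + σ ^ 2 * ∑ A : ι → α, (∏ i, ρ (A i)) := by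
      simp only [Finset.mul_sum, ← Finset.sum_sub_distrib, ← Finset.sum_add_distrib]
      exact Finset.sum_congr rfl fun A _ => by ring
    rw [hex, sum_prod_eq_one ρ hρ, sum_prod_indicator ρ hρ, sum_prod_indicator ρ hρ]
    split_ifs with h
    · subst h
      have : ∀ A : ι → α, c A r * c A r = c A r := fun A => by simp [hc]
      simp only [this]
      rw [sum_prod_indicator ρ hρ]
      ring
    · rw [sum_prod_indicator_mul_indicator ρ hρ S h]
      ring
  have hsq : ∀ A : ι → α, ((∑ r, c A r) - Fintype.card ι * σ) ^ 2 =
      ∑ r, ∑ s, (c A r - σ) * (c A s - σ) := by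
    intro A
    rw [← Finset.sum_mul_sum, ← sq, Finset.sum_sub_distrib]
    simp
  calc ∑ A : ι → α, (∏ i, ρ (A i)) * ((∑ r, c A r) - Fintype.card ι * σ) ^ 2
      = ∑ r, ∑ s, ∑ A : ι → α, (∏ i, ρ (A i)) * ((c A r - σ) * (c A s - σ)) := by
        simp only [hsq, Finset.mul_sum]
        rw [Finset.sum_comm]
        exact Finset.sum_congr rfl fun r _ => Finset.sum_comm
    _ = Fintype.card ι * (σ - σ ^ 2) := by
        simp only [hpair]
        simp
        ring
    _ ≤ _ := by
        gcongr
        nlinarith [sq_nonneg σ]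

/-- Jensen's inequality for the square of a finite weighted mean. -/
theorem sum_mul_abs_le_sqrt {Ω : Type*} [Fintype Ω] (w X : Ω → ℝ) (hw : ∀ a, 0 ≤ w a)
    (h1 : ∑ a, w a = 1) : ∑ a, w a * |X a| ≤ √(∑ a, w a * X a ^ 2) := by
  refine Real.le_sqrt_of_sq_le ?_
  simpa only [sq_abs] using Real.pow_arith_mean_le_arith_mean_pow_of_even Finset.univ w
    (fun a => |X a|) (fun a _ => hw a) h1 even_two

/-- Conditioning a uniformly random coordinate of a product measure to lie in `S` changes the
mean of a bounded function by at most the inverse square root of the mean number of coordinates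
in `S`. -/
theorem abs_sum_prod_sub_average_le [Nonempty ι] (ρ : α → ℝ) (hρ0 : ∀ v, 0 ≤ ρ v)
    (hρ : ∑ v, ρ v = 1) (S : Finset α) (hS : 0 < ∑ v ∈ S, ρ v) (G : (ι → α) → ℝ)
    (hG : ∀ A, |G A| ≤ 1) :
    |(∑ A : ι → α, (∏ i, ρ (A i)) * G A) - (∑ r, ∑ A : ι → α, (∏ i, ρ (A i)) *
        ∑ v ∈ S, ρ v * G (Function.update A r v)) / (Fintype.card ι * ∑ v ∈ S, ρ v)| ≤
      1 / √(Fintype.card ι * ∑ v ∈ S, ρ v) := by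
  have hn : (0 : ℝ) < Fintype.card ι := by exact_mod_cast Fintype.card_pos
  have hvar := sum_prod_count_sub_sq_le (ι := ι) ρ hρ S
  set m := Fintype.card ι * ∑ v ∈ S, ρ v with hm
  have hm0 : 0 < m := mul_pos hn hS
  set N : (ι → α) → ℝ := fun A => ∑ r, if A r ∈ S then (1 : ℝ) else 0 with hN
  have hw : ∀ A : ι → α, 0 ≤ ∏ i, ρ (A i) := fun A => Finset.prod_nonneg fun i _ => hρ0 _
  have h1 : ∑ r, ∑ A : ι → α, (∏ i, ρ (A i)) * ∑ v ∈ S, ρ v * G (Function.update A r v) =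
      ∑ A : ι → α, (∏ i, ρ (A i)) * (N A * G A) := by
    simp only [← sum_prod_mul_indicator ρ hρ S]
    rw [Finset.sum_comm]
    refine Finset.sum_congr rfl fun A _ => ?_
    rw [← Finset.mul_sum, ← Finset.sum_mul]
  have h2 : (∑ A : ι → α, (∏ i, ρ (A i)) * G A) -
      (∑ A : ι → α, (∏ i, ρ (A i)) * (N A * G A)) / m =
      ∑ A : ι → α, (∏ i, ρ (A i)) * (-(N A - m) * G A) / m := by
    rw [Finset.sum_div, ← Finset.sum_sub_distrib]
    refine Finset.sum_congr rfl fun A _ => ?_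
    field_simp
    ring
  rw [h1, h2]
  -- The error is a relative deviation of the count `N`; its variance is at most its mean `m`, hence
  -- `√m / m`.
  calc _ ≤ ∑ A : ι → α, (∏ i, ρ (A i)) * |N A - m| / m := by
        refine (Finset.abs_sum_le_sum_abs _ _).trans (Finset.sum_le_sum fun A _ => ?_)
        rw [abs_div, abs_mul, abs_mul, abs_neg, abs_of_nonneg (hw A), abs_of_pos hm0]
        gcongr
        · exact hw A
        · exact mul_le_of_le_one_right (abs_nonneg _) (hG A)
    _ = (∑ A : ι → α, (∏ i, ρ (A i)) * |N A - m|) / m := by rw [Finset.sum_div]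
    _ ≤ √m / m := by
        gcongr
        exact (sum_mul_abs_le_sqrt _ _ hw (sum_prod_eq_one ρ hρ)).trans (Real.sqrt_le_sqrt hvar)
    _ = 1 / √m := Real.sqrt_div_self'

end Resampling
end SparseParity

namespace SparseParity

/-! ### Frozen coordinates and locked pairs of a subspace -/

section LockedPairs

variable {ι : Type*} [Fintype ι] (K : Submodule (ZMod 2) (ι → ZMod 2))

open Classical in
/-- The coordinates that vanish on all of `K`. -/
noncomputable def frozenSet : Finset ι := {i | ∀ x ∈ K, x i = 0}

open Classical in
/-- The pairs of coordinates that agree on `K` but do not vanish on `K`. -/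
noncomputable def lockedPairs : Finset (ι × ι) :=
  {p | ¬ (∀ x ∈ K, x p.1 = 0) ∧ ∀ x ∈ K, x p.1 = x p.2}

theorem mem_frozenSet {i : ι} : i ∈ frozenSet K ↔ ∀ x ∈ K, x i = 0 := by
  simp [frozenSet]

theorem mem_lockedPairs {i j : ι} :
    (i, j) ∈ lockedPairs K ↔ ¬ (∀ x ∈ K, x i = 0) ∧ ∀ x ∈ K, x i = x j := by
  simp [lockedPairs]

theorem eq_one_of_ne_zero {b : ZMod 2} (h : b ≠ 0) : b = 1 := by
  revert h; revert b; decide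

/-- Pinning the coordinate `j` to zero freezes the coordinates that are locked to `j`. -/
theorem frozen_of_pinned_iff {i j : ι} :
    (∀ x ∈ K, x j = 0 → x i = 0) ↔ i ∈ frozenSet K ∨ (i, j) ∈ lockedPairs K := by
  rw [mem_frozenSet, mem_lockedPairs]
  constructor
  · intro h
    by_cases hi : ∀ x ∈ K, x i = 0
    · exact Or.inl hi
    refine Or.inr ⟨hi, fun x hx => ?_⟩
    push Not at hi
    obtain ⟨z, hz, hzi⟩ := hi
    have hzj : z j ≠ 0 := fun h0 => hzi (h z hz h0)
    by_cases hxj : x j = 0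
    · rw [hxj, h x hx hxj]
    -- Over `𝔽₂`, `x` and `z` both equal one at `j`, so their difference satisfies the pinning.
    · have := h (x - z) (K.sub_mem hx hz) (by
        simp [eq_one_of_ne_zero hxj, eq_one_of_ne_zero hzj])
      rw [eq_one_of_ne_zero hxj, ← eq_one_of_ne_zero hzi]
      exact sub_eq_zero.1 this
  · rintro (h | ⟨-, h⟩) x hx hxj
    · exact h x hx
    · rw [h x hx, hxj]

/-- The mean increase of the number of frozen coordinates under pinning a uniformly random
coordinate is governed by the number of locked pairs. -/
theorem sum_card_frozenSet_pinned (K' : ι → Submodule (ZMod 2) (ι → ZMod 2))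
    (hK' : ∀ j x, x ∈ K' j ↔ x ∈ K ∧ x j = 0) :
    ∑ j, (frozenSet (K' j)).card =
      Fintype.card ι * (frozenSet K).card + (lockedPairs K).card := by
  classical
  have h : ∀ j, (frozenSet (K' j)).card =
      (frozenSet K).card + (Finset.univ.filter fun i => (i, j) ∈ lockedPairs K).card := by
    intro j
    rw [← Finset.card_union_of_disjoint]
    · congr 1
      ext i
      rw [mem_frozenSet, Finset.mem_union, Finset.mem_filter_univ, ← frozen_of_pinned_iff]
      simp [hK']
    · rw [Finset.disjoint_left]
      intro i hi hi'
      rw [Finset.mem_filter_univ, mem_lockedPairs] at hi'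
      exact hi'.1 ((mem_frozenSet K).1 hi)
  rw [Finset.sum_congr rfl fun j _ => h j, Finset.sum_add_distrib]
  congr 1
  · simp
  · simp only [Finset.card_filter]
    rw [← Fintype.sum_prod_type_right' (fun i j => if (i, j) ∈ lockedPairs K then 1 else 0)]
    simp

/-- The nontrivial character of `𝔽₂`. -/
def sign (b : ZMod 2) : ℝ := if b = 0 then 1 else -1

theorem sign_add (a b : ZMod 2) : sign (a + b) = sign a * sign b := by
  by_cases ha : a = 0 <;> by_cases hb : b = 0
  · simp [sign, ha, hb]
  · simp [sign, ha, hb]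
  · simp [sign, ha, hb]
  · rw [eq_one_of_ne_zero ha, eq_one_of_ne_zero hb, CharTwo.add_self_eq_zero]
    simp [sign]

/-- Orthogonality of characters: if the pair is not locked, translation by some `z ∈ K` with `z i ≠
z j` flips every summand's sign. -/
theorem sum_sign_mul_sign {i j : ι} (hi : i ∉ frozenSet K) [Fintype K]
    [Decidable ((i, j) ∈ lockedPairs K)] :
    ∑ y : K, sign (y.1 i) * sign (y.1 j) =
      if (i, j) ∈ lockedPairs K then (Fintype.card K : ℝ) else 0 := by
  rw [mem_frozenSet] at hi
  simp only [← sign_add]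
  split_ifs with h
  · rw [mem_lockedPairs] at h
    have : ∀ y : K, sign (y.1 i + y.1 j) = 1 := fun y => by
      rw [h.2 y.1 y.2, CharTwo.add_self_eq_zero]
      simp [sign]
    simp [this]
  · rw [mem_lockedPairs] at h
    have h' : ∃ z ∈ K, z i ≠ z j := by
      by_contra! hc
      exact h ⟨hi, hc⟩
    obtain ⟨z, hz, hne⟩ := h'
    have hz1 : sign (z i + z j) = -1 := by
      rw [sign, if_neg]
      rwa [CharTwo.add_eq_zero]
    have hshift := Equiv.sum_comp (Equiv.addRight (⟨z, hz⟩ : K))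
      (fun y : K => sign (y.1 i + y.1 j))
    have hflip : ∀ y : K, sign ((Equiv.addRight (⟨z, hz⟩ : K) y).1 i +
        (Equiv.addRight (⟨z, hz⟩ : K) y).1 j) = - sign (y.1 i + y.1 j) := by
      intro y
      have : (Equiv.addRight (⟨z, hz⟩ : K) y).1 i + (Equiv.addRight (⟨z, hz⟩ : K) y).1 j =
          (y.1 i + y.1 j) + (z i + z j) := by
        simp only [Equiv.coe_addRight, Submodule.coe_add, Pi.add_apply]
        ring
      rw [this, sign_add, hz1, mul_neg_one]
    simp only [hflip, Finset.sum_neg_distrib] at hshift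
    linarith

/-- The variance of the number of zeros of a uniformly random element of `K`. -/
theorem sum_card_zeros_sub_sq [Fintype K] :
    ∑ y : K, ((∑ i, if y.1 i = 0 then (1 : ℝ) else 0) -
      ((Fintype.card ι : ℝ) + (frozenSet K).card) / 2) ^ 2 =
      (Fintype.card K : ℝ) * ((lockedPairs K).card / 4) := by
  classical
  have hdev : ∀ y : K, (∑ i, if y.1 i = 0 then (1 : ℝ) else 0) -
      ((Fintype.card ι : ℝ) + (frozenSet K).card) / 2 =
      ∑ i ∈ (frozenSet K)ᶜ, sign (y.1 i) / 2 := by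
    intro y
    have h1 : ∀ i, (if y.1 i = 0 then (1 : ℝ) else 0) = sign (y.1 i) / 2 + 1 / 2 := by
      intro i
      unfold sign
      split_ifs <;> norm_num
    have h2 : ∑ i ∈ frozenSet K, sign (y.1 i) / 2 = (frozenSet K).card / 2 := by
      rw [Finset.sum_congr rfl fun i hi =>
        show sign (y.1 i) / 2 = 1 / 2 by rw [(mem_frozenSet K).1 hi y.1 y.2]; simp [sign]]
      simp [div_eq_mul_inv]
    simp only [h1, Finset.sum_add_distrib]
    rw [← Finset.sum_add_sum_compl (frozenSet K) (fun i => sign (y.1 i) / 2), h2]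
    simp
    ring
  -- No locked pair involves a frozen coordinate, so restricting both sums to the unfrozen ones
  -- loses none.
  have hsupp : ∀ i j, (i, j) ∈ lockedPairs K → i ∉ frozenSet K ∧ j ∉ frozenSet K := by
    intro i j h
    rw [mem_lockedPairs] at h
    rw [mem_frozenSet, mem_frozenSet]
    exact ⟨h.1, fun hj => h.1 fun x hx => (h.2 x hx).trans (hj x hx)⟩
  have hcard : ((lockedPairs K).card : ℝ) =
      ∑ i ∈ (frozenSet K)ᶜ, ∑ j ∈ (frozenSet K)ᶜ, if (i, j) ∈ lockedPairs K then 1 else 0 := by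
    rw [← Finset.sum_product', Finset.sum_ite_mem, Finset.sum_const, nsmul_eq_mul, mul_one,
      Finset.inter_eq_right.2]
    rintro ⟨i, j⟩ h
    simpa using hsupp i j h
  calc _ = ∑ y : K, ∑ i ∈ (frozenSet K)ᶜ, ∑ j ∈ (frozenSet K)ᶜ,
        sign (y.1 i) * sign (y.1 j) / 4 := by
        refine Finset.sum_congr rfl fun y _ => ?_
        rw [hdev, sq, Finset.sum_mul_sum]
        refine Finset.sum_congr rfl fun i _ => Finset.sum_congr rfl fun j _ => ?_
        ring
    _ = ∑ i ∈ (frozenSet K)ᶜ, ∑ j ∈ (frozenSet K)ᶜ,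
        ∑ y : K, sign (y.1 i) * sign (y.1 j) / 4 := by
        rw [Finset.sum_comm]
        exact Finset.sum_congr rfl fun i _ => Finset.sum_comm
    _ = ∑ i ∈ (frozenSet K)ᶜ, ∑ j ∈ (frozenSet K)ᶜ,
        (Fintype.card K : ℝ) * ((if (i, j) ∈ lockedPairs K then 1 else 0) / 4) := by
        refine Finset.sum_congr rfl fun i hi => Finset.sum_congr rfl fun j _ => ?_
        rw [← Finset.sum_div, sum_sign_mul_sign K (Finset.mem_compl.1 hi)]
        split_ifs <;> ring
    _ = _ := by
        rw [hcard]
        simp only [Finset.sum_div, Finset.mul_sum]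

end LockedPairs
end SparseParity

namespace SparseParity

/-! ### Zero rows, unit rows and the mean number of locked pairs -/

section RandomMatrix

variable {n : ℕ}

/-- The probability that a row of the random matrix equals `v`. -/
noncomputable def rowWeight (p : ℝ≥0) (v : Fin n → ZMod 2) : ℝ :=
  ∏ j, (entryWeight p (v j)).toReal

theorem rowWeight_nonneg (p : ℝ≥0) (v : Fin n → ZMod 2) : 0 ≤ rowWeight p v :=
  Finset.prod_nonneg fun _ _ => ENNReal.toReal_nonneg

theorem entryWeight_ne_top (p : ℝ≥0) (b : ZMod 2) : entryWeight p b ≠ ∞ := by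
  unfold entryWeight
  split_ifs <;> exact ENNReal.coe_ne_top

theorem sum_rowWeight {p : ℝ≥0} (hp : p ≤ 1) : ∑ v : Fin n → ZMod 2, rowWeight p v = 1 := by
  refine sum_prod_eq_one (fun b => (entryWeight p b).toReal) ?_
  rw [← ENNReal.toReal_sum fun b _ => entryWeight_ne_top p b, sum_entryWeight hp,
    ENNReal.toReal_one]

theorem entryWeight_one_toReal (p : ℝ≥0) : (entryWeight p 1).toReal = p := by
  simp [entryWeight]

theorem entryWeight_zero_toReal {p : ℝ≥0} (hp : p ≤ 1) :
    (entryWeight p 0).toReal = 1 - p := by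
  rw [entryWeight, if_neg (by decide), ENNReal.coe_toReal, NNReal.coe_sub hp, NNReal.coe_one]

theorem rowWeight_zero {p : ℝ≥0} (hp : p ≤ 1) :
    rowWeight p (0 : Fin n → ZMod 2) = (1 - p) ^ n := by
  simp [rowWeight, entryWeight_zero_toReal hp]

theorem rowWeight_single {p : ℝ≥0} (hp : p ≤ 1) (j : Fin n) :
    rowWeight p (Pi.single j 1 : Fin n → ZMod 2) = p * (1 - p) ^ (n - 1) := by
  rw [rowWeight, Fintype.prod_eq_mul_prod_compl j, Pi.single_eq_same, entryWeight_one_toReal,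
    Finset.prod_congr rfl fun i hi => show _ = (1 - p : ℝ) by
      rw [Pi.single_eq_of_ne (by simpa using hi), entryWeight_zero_toReal hp]]
  simp [Finset.card_compl]

theorem matrixLaw_toReal (d : ℝ) (A : Matrix (Fin n) (Fin n) (ZMod 2)) :
    (matrixLaw d n A).toReal = ∏ i, rowWeight (entryProb d n) (A i) := by
  have h : matrixLaw d n A = ∏ i, ∏ j, entryWeight (entryProb d n) (A i j) := rfl
  rw [h]
  simp only [rowWeight, ENNReal.toReal_prod]

theorem mem_kernel_update (A : Fin n → Fin n → ZMod 2) (r : Fin n) (v x : Fin n → ZMod 2) :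
    x ∈ kernel (Function.update A r v) ↔ v ⬝ᵥ x = 0 ∧ ∀ s, s ≠ r → A s ⬝ᵥ x = 0 := by
  refine LinearMap.mem_ker.trans (funext_iff.trans ?_)
  change (∀ s, Function.update A r v s ⬝ᵥ x = 0) ↔ _
  constructor
  · intro h
    refine ⟨by simpa using h r, fun s hs => ?_⟩
    simpa [Function.update_of_ne hs] using h s
  · rintro ⟨h, h'⟩ s
    by_cases hs : s = r
    · subst hs
      simpa using h
    · simpa [Function.update_of_ne hs] using h' s hs

theorem mem_kernel_update_single (A : Fin n → Fin n → ZMod 2) (r j : Fin n)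
    (x : Fin n → ZMod 2) :
    x ∈ kernel (Function.update A r (Pi.single j 1)) ↔
      x ∈ kernel (Function.update A r 0) ∧ x j = 0 := by
  rw [mem_kernel_update, mem_kernel_update, single_one_dotProduct, zero_dotProduct]
  tauto

/-- The mean number of locked pairs of the random matrix is of smaller order than `n ^ 2`,
provided the mean numbers of zero rows and of rows with a single one are large. -/
theorem sum_lockedPairs_le [NeZero n] {p : ℝ≥0} (hp0 : 0 < p) (hp : p < 1) :
    ∑ A : Fin n → Fin n → ZMod 2, (∏ i, rowWeight p (A i)) *
      ((lockedPairs (kernel A)).card / (n : ℝ) ^ 2) ≤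
    2 / √(n * (1 - p) ^ n) + 1 / √(n * (n * (p * (1 - p) ^ (n - 1)))) := by
  classical
  have hn : (0 : ℝ) < n := by exact_mod_cast Nat.pos_of_ne_zero (NeZero.ne n)
  have hp' : (0 : ℝ) < 1 - p := sub_pos.2 (by exact_mod_cast hp)
  have hp0' : (0 : ℝ) < p := by exact_mod_cast hp0
  set φ : (Fin n → Fin n → ZMod 2) → ℝ := fun A => (frozenSet (kernel A)).card / n with hφ
  set ψ : (Fin n → Fin n → ZMod 2) → ℝ :=
    fun A => (lockedPairs (kernel A)).card / (n : ℝ) ^ 2 with hψ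
  have hφ1 : ∀ A, |φ A| ≤ 1 := fun A => by
    rw [abs_of_nonneg (by positivity)]
    refine div_le_one_of_le₀ ?_ hn.le
    exact_mod_cast (Finset.card_le_univ _).trans_eq (Fintype.card_fin n)
  have hψ1 : ∀ A, |ψ A| ≤ 1 := fun A => by
    rw [abs_of_nonneg (by positivity)]
    refine div_le_one_of_le₀ ?_ (by positivity)
    have := Finset.card_le_univ (lockedPairs (kernel A))
    rw [Fintype.card_prod, Fintype.card_fin, ← sq] at this
    exact_mod_cast this
  have hstep : ∀ (A : Fin n → Fin n → ZMod 2) (r : Fin n),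
      ∑ j, φ (Function.update A r (Pi.single j 1)) =
        n * (φ (Function.update A r 0) + ψ (Function.update A r 0)) := by
    intro A r
    have h := sum_card_frozenSet_pinned (kernel (Function.update A r 0))
      (fun j => kernel (Function.update A r (Pi.single j 1)))
      (fun j x => mem_kernel_update_single A r j x)
    have h' : (∑ j, ((frozenSet (kernel (Function.update A r (Pi.single j 1)))).card : ℝ)) =
        n * (frozenSet (kernel (Function.update A r 0))).card +
          (lockedPairs (kernel (Function.update A r 0))).card := by
      rw [Fintype.card_fin] at h
      exact_mod_cast h
    simp only [hφ, hψ]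
    rw [← Finset.sum_div, h']
    field_simp
  -- `Z G / n` is the mean of `G` once a uniformly random row is set to zero; `M G` is the plain
  -- mean.
  set Z : ((Fin n → Fin n → ZMod 2) → ℝ) → ℝ := fun G =>
    ∑ r, ∑ A : Fin n → Fin n → ZMod 2, (∏ i, rowWeight p (A i)) * G (Function.update A r 0)
    with hZ
  set M : ((Fin n → Fin n → ZMod 2) → ℝ) → ℝ := fun G =>
    ∑ A : Fin n → Fin n → ZMod 2, (∏ i, rowWeight p (A i)) * G A with hM
  have hzero : ∀ G : (Fin n → Fin n → ZMod 2) → ℝ, (∀ A, |G A| ≤ 1) →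
      |M G - Z G / n| ≤ 1 / √(n * (1 - p) ^ n) := by
    intro G hG
    have h := abs_sum_prod_sub_average_le (ι := Fin n) (rowWeight p) (rowWeight_nonneg p)
      (sum_rowWeight hp.le) {0} (by rw [Finset.sum_singleton, rowWeight_zero hp.le]; positivity)
      G hG
    simp only [Finset.sum_singleton, rowWeight_zero hp.le, Fintype.card_fin] at h
    convert h using 3
    rw [mul_comm (n : ℝ), ← div_div]
    congr 1
    rw [eq_div_iff (by positivity), hZ, Finset.sum_mul]
    refine Finset.sum_congr rfl fun r _ => ?_
    rw [Finset.sum_mul]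
    exact Finset.sum_congr rfl fun A _ => by ring
  have hone : |M φ - (Z φ + Z ψ) / n| ≤ 1 / √(n * (n * (p * (1 - p) ^ (n - 1)))) := by
    have hinj : Function.Injective fun j : Fin n => (Pi.single j 1 : Fin n → ZMod 2) :=
      fun i j h => by
        by_contra hij
        have := congrFun h i
        simp [Pi.single_eq_of_ne hij] at this
    have hsum : ∀ F : (Fin n → ZMod 2) → ℝ,
        ∑ v ∈ Finset.univ.map ⟨_, hinj⟩, F v = ∑ j, F (Pi.single j 1) := fun F => by
      rw [Finset.sum_map]; rfl
    have h := abs_sum_prod_sub_average_le (ι := Fin n) (rowWeight p) (rowWeight_nonneg p)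
      (sum_rowWeight hp.le) (Finset.univ.map ⟨_, hinj⟩)
      (by simp only [hsum, rowWeight_single hp.le]
          simp only [Finset.sum_const, Finset.card_univ, Fintype.card_fin, nsmul_eq_mul]
          positivity)
      φ hφ1
    simp only [hsum, rowWeight_single hp.le, ← Finset.mul_sum, hstep] at h
    simp only [Finset.sum_const, Finset.card_univ, Fintype.card_fin, nsmul_eq_mul] at h
    rw [mul_left_comm (p : ℝ)] at h
    convert h using 3
    rw [div_eq_div_iff (by positivity) (by positivity), hZ]
    simp only [add_mul, Finset.sum_mul, ← Finset.sum_add_distrib]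
    exact Finset.sum_congr rfl fun r _ => Finset.sum_congr rfl fun A _ => by ring
  -- `M φ` is close to both `Z φ / n` and `(Z φ + Z ψ) / n`, so `Z ψ / n` is small, and `M ψ` is
  -- close to it. The zero-row estimate enters twice, hence the constant 2.
  have h1 := abs_le.1 (hzero φ hφ1)
  have h2 := abs_le.1 (hzero ψ hψ1)
  have h3 := abs_le.1 hone
  have h4 : (2 : ℝ) / √(n * (1 - p) ^ n) = 1 / √(n * (1 - p) ^ n) + 1 / √(n * (1 - p) ^ n) := by
    ring
  rw [add_div] at h3
  change M ψ ≤ _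
  linarith [h1.1, h1.2, h2.1, h2.2, h3.1, h3.2]

end RandomMatrix

/-! ### Conditional variance of the overlap -/

section JointLaw

variable {n : ℕ}

theorem frozenFraction_eq (A : Matrix (Fin n) (Fin n) (ZMod 2)) :
    frozenFraction A = (frozenSet (kernel A)).card / n := by
  classical
  rw [frozenFraction, ← Set.ncard_coe_finset]
  congr 3
  ext i
  simp [mem_frozenSet]

open Classical in
theorem uniformKernel_toReal (A : Matrix (Fin n) (Fin n) (ZMod 2)) (x : Fin n → ZMod 2) :
    (uniformKernel A x).toReal =
      if x ∈ kernel A then (Fintype.card (kernel A) : ℝ)⁻¹ else 0 := by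
  rw [uniformKernel, PMF.map_apply, tsum_fintype]
  split_ifs with h
  · rw [Finset.sum_eq_single ⟨x, h⟩]
    · simp
    · intro b _ hb
      rw [if_neg]
      rintro rfl
      exact hb rfl
    · simp
  · rw [Finset.sum_eq_zero, ENNReal.toReal_zero]
    intro b _
    rw [if_neg]
    rintro rfl
    exact h b.2

theorem jointLaw_apply (d : ℝ) (A : Matrix (Fin n) (Fin n) (ZMod 2)) (x x' : Fin n → ZMod 2) :
    jointLaw d n (A, x, x') = matrixLaw d n A * (uniformKernel A x * uniformKernel A x') := by
  classical
  simp only [jointLaw, PMF.bind_apply, tsum_fintype, PMF.pure_apply, Prod.mk.injEq]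
  rw [Finset.sum_eq_single A]
  · congr 1
    rw [Finset.sum_eq_single x]
    · congr 1
      rw [Finset.sum_eq_single x'] <;> simp +contextual [eq_comm]
    · intro b _ hb
      simp [hb.symm]
    · simp
  · intro B _ hB
    simp [hB.symm]
  · simp

/-- The conditional variance of the overlap given the matrix. -/
theorem sum_uniformKernel_overlap_sq [NeZero n] (A : Matrix (Fin n) (Fin n) (ZMod 2)) :
    ∑ x, ∑ x', (uniformKernel A x).toReal * (uniformKernel A x').toReal *
      (overlap x x' - (1 + frozenFraction A) / 2) ^ 2 =
      (lockedPairs (kernel A)).card / (n : ℝ) ^ 2 / 4 := by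
  classical
  have hn : (n : ℝ) ≠ 0 := by exact_mod_cast NeZero.ne n
  have hK : (Fintype.card (kernel A) : ℝ) ≠ 0 := by exact_mod_cast Fintype.card_ne_zero
  set h : (Fin n → ZMod 2) → ℝ := fun y =>
    ((∑ i, if y i = 0 then (1 : ℝ) else 0) -
      ((Fintype.card (Fin n) : ℝ) + (frozenSet (kernel A)).card) / 2) ^ 2 with hh
  have hdev : ∀ x x' : Fin n → ZMod 2,
      (overlap x x' - (1 + frozenFraction A) / 2) ^ 2 = h (x - x') / (n : ℝ) ^ 2 := by
    intro x x'
    simp only [hh, Pi.sub_apply, sub_eq_zero, overlap, frozenFraction_eq, Fintype.card_fin]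
    rw [← div_pow]
    congr 1
    field_simp
  have hrestrict : ∀ F : (Fin n → ZMod 2) → ℝ,
      ∑ x, (if x ∈ kernel A then (Fintype.card (kernel A) : ℝ)⁻¹ else 0) * F x =
        (Fintype.card (kernel A) : ℝ)⁻¹ * ∑ y : kernel A, F y := by
    intro F
    simp only [ite_mul, zero_mul]
    rw [← Finset.sum_filter, ← Finset.mul_sum]
    congr 1
    exact Finset.sum_subtype _ (by simp) _
  simp only [hdev, uniformKernel_toReal, mul_assoc, ← Finset.mul_sum]
  simp only [hrestrict]
  have hshift : ∀ x : kernel A, ∑ x' : kernel A, h (x.1 - x'.1) / (n : ℝ) ^ 2 =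
      (Fintype.card (kernel A) : ℝ) * ((lockedPairs (kernel A)).card / 4) / (n : ℝ) ^ 2 := by
    intro x
    rw [← sum_card_zeros_sub_sq (kernel A), ← Finset.sum_div]
    congr 1
    -- For fixed `x`, the map `x' ↦ x - x'` permutes the kernel.
    exact Equiv.sum_comp (Equiv.subLeft x) fun y : kernel A => h y
  simp only [hshift]
  simp only [Finset.sum_const, Finset.card_univ, nsmul_eq_mul]
  field_simp

theorem expectation_overlap_le [NeZero n] (d : ℝ) :
    expectation (jointLaw d n) (fun ω =>
        |overlap ω.2.1 ω.2.2 - (1 + frozenFraction ω.1) / 2|) ≤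
      √((∑ A : Fin n → Fin n → ZMod 2, (∏ i, rowWeight (entryProb d n) (A i)) *
        ((lockedPairs (kernel A)).card / (n : ℝ) ^ 2)) / 4) := by
  have hone : ∑ ω, (jointLaw d n ω).toReal = 1 := by
    rw [← ENNReal.toReal_sum fun ω _ => PMF.apply_ne_top _ ω, ← tsum_fintype (L := .unconditional _),
      PMF.tsum_coe,
      ENNReal.toReal_one]
  refine (sum_mul_abs_le_sqrt _ _ (fun ω => ENNReal.toReal_nonneg) hone).trans_eq ?_
  congr 1
  simp only [Fintype.sum_prod_type, jointLaw_apply, ENNReal.toReal_mul, matrixLaw_toReal]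
  rw [Finset.sum_div]
  refine Finset.sum_congr rfl fun A _ => ?_
  rw [mul_div_assoc, ← sum_uniformKernel_overlap_sq]
  simp only [Finset.mul_sum, mul_assoc]

end JointLaw

/-! ### Asymptotics for entry probability `d / n` -/

open Filter Topology

theorem tendsto_natCast_mul_one_sub_div_pow (d : ℝ) :
    Tendsto (fun n : ℕ => (n : ℝ) * (1 - d / n) ^ n) atTop atTop := by
  have h := Real.tendsto_one_add_div_pow_exp (-d)
  simp only [neg_div, ← sub_eq_add_neg] at h
  exact tendsto_natCast_atTop_atTop.atTop_mul_pos (Real.exp_pos _) h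

theorem coe_entryProb {d : ℝ} (hd : 0 < d) {n : ℕ} (hn : d < n) :
    (entryProb d n : ℝ) = d / n := by
  have hn0 : 0 < (n : ℝ) := hd.trans hn
  rw [entryProb, NNReal.coe_min, Real.coe_toNNReal _ (by positivity), NNReal.coe_one]
  exact min_eq_left ((div_le_one hn0).2 hn.le)

/-- Both errors are expressed through `n * (1 - d / n) ^ n`, which grows like `n * exp (-d)`. -/
theorem sum_lockedPairs_entryProb_le {d : ℝ} (hd : 0 < d) {n : ℕ} [NeZero n] (hn : d < n) :
    ∑ A : Fin n → Fin n → ZMod 2, (∏ i, rowWeight (entryProb d n) (A i)) *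
      ((lockedPairs (kernel A)).card / (n : ℝ) ^ 2) ≤
    2 / √(n * (1 - d / n) ^ n) + 1 / √(d * (n * (1 - d / n) ^ n)) := by
  have hn0 : 0 < (n : ℝ) := hd.trans hn
  have hp := coe_entryProb hd hn
  have hlt : d / n < 1 := (div_lt_one hn0).2 hn
  have hpos : 0 < 1 - d / n := sub_pos.2 hlt
  have h := sum_lockedPairs_le (n := n) (p := entryProb d n)
    (by rw [← NNReal.coe_pos, hp]; positivity) (by rw [← NNReal.coe_lt_coe, hp]; simpa using hlt)
  rw [hp] at h
  refine h.trans (add_le_add_right (one_div_le_one_div_of_le (Real.sqrt_pos.2 (by positivity))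
    (Real.sqrt_le_sqrt ?_)) _)
  have h1 : (1 - d / n) ^ n ≤ (1 - d / n) ^ (n - 1) :=
    pow_le_pow_of_le_one hpos.le (by linarith [div_pos hd hn0]) (Nat.sub_le n 1)
  calc d * (n * (1 - d / n) ^ n) ≤ d * (n * (1 - d / n) ^ (n - 1)) := by gcongr
    _ = n * (n * (d / n * (1 - d / n) ^ (n - 1))) := by field_simp

end SparseParity

open SparseParity Filter Topology in
theorem corollary2p12 (d : ℝ) (hd : 0 < d) :
    Filter.Tendsto
      (fun n : ℕ => SparseParity.expectation (SparseParity.jointLaw d n) fun ω =>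
        |SparseParity.overlap ω.2.1 ω.2.2 - (1 + SparseParity.frozenFraction ω.1) / 2|)
      Filter.atTop (nhds 0) := by
  have hlim : Tendsto (fun n : ℕ => √((2 / √(n * (1 - d / n) ^ n) +
      1 / √(d * (n * (1 - d / n) ^ n))) / 4)) atTop (𝓝 0) := by
    have h0 := tendsto_natCast_mul_one_sub_div_pow d
    have h1 := (Real.tendsto_sqrt_atTop.comp h0).const_div_atTop 2
    have h2 := (Real.tendsto_sqrt_atTop.comp (h0.const_mul_atTop hd)).const_div_atTop 1
    have h3 := (h1.add h2).div_const 4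
    rw [add_zero, zero_div] at h3
    exact Real.sqrt_zero ▸ (Real.continuous_sqrt.tendsto 0).comp h3
  refine tendsto_of_tendsto_of_tendsto_of_le_of_le' tendsto_const_nhds hlim
    (Eventually.of_forall fun n => ?_) ?_
  · exact Finset.sum_nonneg fun ω _ => mul_nonneg ENNReal.toReal_nonneg (abs_nonneg _)
  · filter_upwards [tendsto_natCast_atTop_atTop.eventually_gt_atTop d] with n hn
    have : NeZero n := ⟨by rintro rfl; simp at hn; linarith⟩
    refine (expectation_overlap_le d).trans (Real.sqrt_le_sqrt ?_)
    gcongr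
    exact sum_lockedPairs_entryProb_le hd hn
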